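/- Let $S$ be a non-empty finite or countably infinite set and let $P=(p_{ij})_{i,j\in S}$ be a stochastic matrix ($p_{ij}\ge 0$, $\sum_j p_{ij}=1$). A Markov chain with transition matrix $P$ and initial distribution $\nu$ is a sequence $(X_n)_{n\ge 0}$ of $S$-valued random variables such that $X_0$ has law $\nu$ and $\mathbb{P}(X_{n+1}=j\mid X_0=i_0,\dots,X_n=i_n)=p_{i_nj}$ whenever the conditioning event has positive probability; $\mathbb{P}_\nu$ denotes its law, and $\mathbb{P}_i=\mathbb{P}_{\delta_i}$. Assume that $P$ is - irreducible: for all $i,j\in S$ there is $n\ge 0$ with $(P^n)_{ij}>0$; - aperiodic: $\gcd\{n\ge 1 : \mathbb{P}_i(X_n=i)>0\}=1$ for every $i\in S$; - positive recurrent: $\mathbb{E}_i[\tau_i]<\infty$ for every $i\in S$, where $\tau_i=\inf\{n\ge 1 : X_n=i\}\in\mathbb{N}\cup\{\infty\}$. Then there is a unique stationary distribution $\pi$, that is, a unique probability distribution $\pi$ on $S$ with $\pi_j=\sum_{i\in S}\pi_i p_{ij}$ for all $j\in S$, and for every initial distribution $\nu$ on $S$ and every state $j\in S$, $$\lim_{n\to\infty}\mathbb{P}_\nu(X_n=j)=\pi_j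 .$$ -/

import Mathlib

/-!
Markov chains on a countable discrete state space `S`.  A stochastic matrix `(p i j)` is a map
`P : S → PMF S`, with `p i j = P i j`; probability distributions on `S` are terms of `PMF S`.
-/

open MeasureTheory ProbabilityTheory Filter
open scoped ENNReal Topology

namespace MarkovChain

variable {S : Type*}

/-- A discrete-time process `X` on the probability space `(Ω, μ)` is a Markov chain with transition
matrix `P` and initial distribution `ν`: the law of `X 0` is `ν`, and the conditional probability of
`X (n + 1) = j` given `X 0 = x 0, …, X n = x n` is `P (x n) j`, whenever that conditioning event has
positive probability. -/
structure IsMarkovChain [MeasurableSpace S] {Ω : Type*} [MeasurableSpace Ω] (P : S → PMF S)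
    (ν : PMF S) (μ : Measure Ω) (X : ℕ → Ω → S) : Prop where
  measurable : ∀ n, Measurable (X n)
  initial : ∀ i, μ {ω | X 0 ω = i} = ν i
  markov : ∀ (n : ℕ) (x : ℕ → S) (j : S), μ {ω | ∀ k ≤ n, X k ω = x k} ≠ 0 →
    μ[{ω | X (n + 1) ω = j} | {ω | ∀ k ≤ n, X k ω = x k}] = P (x n) j

/-- The `n`-step transition probabilities, i.e. the entries of the matrix power `P ^ n`. -/
noncomputable def nStep (P : S → PMF S) : ℕ → S → S → ℝ≥0∞
  | 0 => fun i j => PMF.pure i j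
  | n + 1 => fun i j => ∑' k, nStep P n i k * P k j

/-- `j` is accessible from `i`. -/
def Accessible (P : S → PMF S) (i j : S) : Prop := ∃ n : ℕ, 0 < nStep P n i j

/-- Every state is accessible from every state. -/
def IsIrreducible (P : S → PMF S) : Prop := ∀ i j, Accessible P i j ∧ Accessible P j i

/-- A stationary distribution: `π j = ∑ i, π i * p i j` for all `j`. -/
def IsStationary (P : S → PMF S) (π : PMF S) : Prop := ∀ j, π j = ∑' i, π i * P i j

section PathMeasure

variable [MeasurableSpace S] [Countable S] [MeasurableSingletonClass S]

/-- The transition matrix as a Markov kernel. -/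
noncomputable def transitionKernel (P : S → PMF S) : Kernel S S :=
  Kernel.ofFunOfCountable fun i => (P i).toMeasure

instance instIsMarkovKernelTransition (P : S → PMF S) : IsMarkovKernel (transitionKernel P) :=
  ⟨fun i => inferInstanceAs (IsProbabilityMeasure (P i).toMeasure)⟩

/-- The kernel giving the law of the state at time `n + 1` from the trajectory up to time `n`. -/
noncomputable def stepKernel (P : S → PMF S) (n : ℕ) :
    Kernel ((i : Finset.Iic n) → (fun _ : ℕ => S) i) ((fun _ : ℕ => S) (n + 1)) :=
  (transitionKernel P).comap (fun x => x ⟨n, Finset.mem_Iic.2 le_rfl⟩) (measurable_pi_apply _)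

instance instIsMarkovKernelStep (P : S → PMF S) (n : ℕ) : IsMarkovKernel (stepKernel P n) :=
  inferInstanceAs (IsMarkovKernel ((transitionKernel P).comap _ _))

/-- The law `P_ν` on trajectories `ℕ → S` of the chain with transition matrix `P` and initial
distribution `ν` (given by the Ionescu-Tulcea theorem). -/
noncomputable def pathMeasure (P : S → PMF S) (ν : PMF S) : Measure (ℕ → S) :=
  Kernel.trajMeasure (X := fun _ : ℕ => S) ν.toMeasure (stepKernel P)

instance instIsProbabilityMeasurePath (P : S → PMF S) (ν : PMF S) :
    IsProbabilityMeasure (pathMeasure P ν) :=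
  inferInstanceAs (IsProbabilityMeasure
    (Kernel.trajMeasure (X := fun _ : ℕ => S) ν.toMeasure (stepKernel P)))

/-- The coordinate process under `P_ν` is a Markov chain with transition matrix `P` and initial
distribution `ν`. -/
theorem isMarkovChain_pathMeasure (P : S → PMF S) (ν : PMF S) :
    IsMarkovChain P ν (pathMeasure P ν) (fun n ω => ω n) where
  measurable n := measurable_pi_apply n
  initial i := by
    have h0 : (pathMeasure P ν).map (Preorder.frestrictLe (π := fun _ : ℕ => S) 0) =
        ν.toMeasure.map (MeasurableEquiv.piUnique (fun i : Finset.Iic 0 => S)).symm := by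
      rw [pathMeasure, Kernel.trajMeasure, Measure.map_comp _ _ (by fun_prop),
        Kernel.traj_map_frestrictLe, Kernel.partialTraj_self, Measure.id_comp]
    have h1 : {ω : ℕ → S | ω 0 = i} = Preorder.frestrictLe (π := fun _ : ℕ => S) 0 ⁻¹'
        {y | y ⟨0, Finset.mem_Iic.2 le_rfl⟩ = i} := rfl
    have hm : MeasurableSet {y : (Finset.Iic 0) → S | y ⟨0, Finset.mem_Iic.2 le_rfl⟩ = i} :=
      (measurable_pi_apply (X := fun _ : Finset.Iic 0 => S) ⟨0, Finset.mem_Iic.2 le_rfl⟩)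
        (measurableSet_singleton i)
    rw [h1, ← Measure.map_apply (by fun_prop) hm, h0, Measure.map_apply (by fun_prop) hm]
    exact PMF.toMeasure_apply_singleton ν i (measurableSet_singleton i)
  markov n x j hA := by
    have h := Kernel.map_frestrictLe_trajMeasure_compProd_eq_map_trajMeasure
      (X := fun _ : ℕ => S) (μ₀ := ν.toMeasure) (κ := stepKernel P) (a := n)
    change (pathMeasure P ν).map _ ⊗ₘ _ = (pathMeasure P ν).map _ at h
    set r : (i : Finset.Iic n) → S := fun k => x k with hr
    have hAeq : {ω : ℕ → S | ∀ k ≤ n, ω k = x k} =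
        Preorder.frestrictLe (π := fun _ : ℕ => S) n ⁻¹' {r} := by
      ext ω
      simp [funext_iff, hr]
    have hms : MeasurableSet {ω : ℕ → S | ∀ k ≤ n, ω k = x k} := by
      rw [hAeq]
      exact (by fun_prop : Measurable (Preorder.frestrictLe (π := fun _ : ℕ => S) n))
        (measurableSet_singleton r)
    have h2 := congrArg (fun m => m ({r} ×ˢ {j})) h
    rw [Measure.compProd_apply_prod (measurableSet_singleton r) (measurableSet_singleton j),
      Measure.map_apply (by fun_prop)
        ((measurableSet_singleton r).prod (measurableSet_singleton j)),
      lintegral_singleton, Measure.map_apply (by fun_prop) (measurableSet_singleton r),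
      ← hAeq] at h2
    have h3 : stepKernel P n r {j} = P (x n) j :=
      PMF.toMeasure_apply_singleton (P (x n)) j (measurableSet_singleton j)
    have h4 : {ω : ℕ → S | ∀ k ≤ n, ω k = x k} ∩ {ω | ω (n + 1) = j} =
        (fun ω : ℕ → S => (Preorder.frestrictLe (π := fun _ : ℕ => S) n ω, ω (n + 1))) ⁻¹'
          ({r} ×ˢ {j}) := by
      rw [hAeq]; rfl
    rw [cond_apply hms, h4, ← h2, h3, mul_comm (P (x n) j), ← mul_assoc,
      ENNReal.inv_mul_cancel hA (measure_ne_top _ _), one_mul]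

/-- The first passage time `inf {n ≥ 1 | X_n = i}`, equal to `⊤` if there is no such `n`. -/
noncomputable def hitTime (i : S) (ω : ℕ → S) : ℕ∞ :=
  ⨅ (n : ℕ) (_ : 1 ≤ n ∧ ω n = i), (n : ℕ∞)

/-- The expected return time `E_i[τ_i]`. -/
noncomputable def meanReturnTime (P : S → PMF S) (i : S) : ℝ≥0∞ :=
  ∫⁻ ω, (hitTime i ω : ℝ≥0∞) ∂(pathMeasure P (PMF.pure i))

/-- Every state `i` satisfies `E_i[τ_i] < ∞`. -/
def IsPositiveRecurrent (P : S → PMF S) : Prop := ∀ i, meanReturnTime P i < ∞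

/-- The period of `i`: the gcd of all `n ≥ 1` with `P_i(X_n = i) > 0`. -/
noncomputable def period (P : S → PMF S) (i : S) : ℕ :=
  Nat.setGcd {n : ℕ | 1 ≤ n ∧ 0 < pathMeasure P (PMF.pure i) {ω | ω n = i}}

/-- Every state has period `1`. -/
def IsAperiodic (P : S → PMF S) : Prop := ∀ i, period P i = 1

end PathMeasure

end MarkovChain

/-! Convergence is proved by an energy argument, with no coupling. Fix `j`, let `π` be stationary,
and put f_n(i) = `nStep P n i j`, so that f_{m+n} is the average of f_n under m steps of the chain.
By stationarity and the variance identity, the second moment of f_n under `π` drops over m steps by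
exactly the mean conditional variance (`IsStationary.secondMoment_eq`). A decreasing sequence in [0,
1] converges, so the drop tends to 0, and so does each single term of the variance: f_n(k) -
f_{m+n}(i) → 0 whenever `π i` > 0 and k is reachable from i in m steps
(`IsStationary.tendsto_nStep_sub`). Aperiodicity and irreducibility give one m that reaches two
given states k and l from i, hence f_n(k) - f_n(l) → 0. Averaging over `ν` and over `π` and
subtracting gives the limit `π j`. Uniqueness is the special case where `ν` is another stationary
law. Existence uses positive recurrence: the expected numbers of visits during an excursion from i
form an invariant measure of mass at most E_i[τ_i] < ∞, which is then normalized
(`exists_isStationary`). -/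

namespace MarkovChain

variable {S : Type*}

/-! ### Powers of the transition matrix. -/

section NStep

theorem tsum_nStep (P : S → PMF S) (n : ℕ) (i : S) : ∑' j, nStep P n i j = 1 := by
  induction n with
  | zero => exact (PMF.pure i).tsum_coe
  | succ n ih =>
    simp only [nStep]
    rw [ENNReal.tsum_comm]
    simp_rw [ENNReal.tsum_mul_left, PMF.tsum_coe, mul_one]
    exact ih

theorem nStep_le_one (P : S → PMF S) (n : ℕ) (i j : S) : nStep P n i j ≤ 1 :=
  (ENNReal.le_tsum j).trans_eq (tsum_nStep P n i)

theorem nStep_ne_top (P : S → PMF S) (n : ℕ) (i j : S) : nStep P n i j ≠ ∞ :=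
  ne_top_of_le_ne_top ENNReal.one_ne_top (nStep_le_one P n i j)

/-- The Chapman–Kolmogorov equations. -/
theorem nStep_add (P : S → PMF S) (m n : ℕ) (i j : S) :
    nStep P (m + n) i j = ∑' k, nStep P m i k * nStep P n k j := by
  induction n generalizing j with
  | zero =>
    rw [tsum_eq_single j fun k hk => by simp [nStep, hk.symm]]
    simp [nStep]
  | succ n ih =>
    rw [← add_assoc]
    simp only [nStep, ih]
    simp_rw [← ENNReal.tsum_mul_right, ← ENNReal.tsum_mul_left]
    rw [ENNReal.tsum_comm]
    simp_rw [mul_assoc]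

theorem nStep_mul_le (P : S → PMF S) (m n : ℕ) (i k j : S) :
    nStep P m i k * nStep P n k j ≤ nStep P (m + n) i j := by
  rw [nStep_add]
  exact ENNReal.le_tsum k

theorem nStep_add_pos {P : S → PMF S} {m n : ℕ} {i k j : S} (h₁ : 0 < nStep P m i k)
    (h₂ : 0 < nStep P n k j) : 0 < nStep P (m + n) i j :=
  (ENNReal.mul_pos h₁.ne' h₂.ne').trans_le (nStep_mul_le P m n i k j)

/-- A stationary distribution is invariant under all powers of the transition matrix. -/
theorem IsStationary.tsum_mul_nStep {P : S → PMF S} {π : PMF S} (hπ : IsStationary P π) (n : ℕ)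
    (j : S) : ∑' i, π i * nStep P n i j = π j := by
  induction n generalizing j with
  | zero =>
    rw [tsum_eq_single j fun k hk => by simp [nStep, hk.symm]]
    simp [nStep]
  | succ n ih =>
    simp only [nStep]
    simp_rw [← ENNReal.tsum_mul_left]
    rw [ENNReal.tsum_comm, hπ j]
    refine tsum_congr fun k => ?_
    rw [← ih k, ← ENNReal.tsum_mul_right]
    simp_rw [mul_assoc]

end NStep

/-! ### Loss of memory through decay of the second moment. -/

section Mixing

/-- The square of the difference of two (finite) extended nonnegative reals. -/
noncomputable def sqDist (x y : ℝ≥0∞) : ℝ≥0∞ := ENNReal.ofReal ((x.toReal - y.toReal) ^ 2)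

theorem sqDist_add_two_mul {x y : ℝ≥0∞} (hx : x ≠ ∞) (hy : y ≠ ∞) :
    sqDist x y + 2 * (x * y) = x ^ 2 + y ^ 2 := by
  lift x to NNReal using hx
  lift y to NNReal using hy
  have h : ((x : ℝ≥0∞) ^ 2 + (y : ℝ≥0∞) ^ 2) = ENNReal.ofReal ((x : ℝ) ^ 2 + (y : ℝ) ^ 2) := by
    rw [ENNReal.ofReal_add (by positivity) (by positivity), ENNReal.ofReal_pow (by positivity),
      ENNReal.ofReal_pow (by positivity)]
    simp
  have h' : (2 * ((x : ℝ≥0∞) * y)) = ENNReal.ofReal (2 * ((x : ℝ) * y)) := by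
    rw [ENNReal.ofReal_mul (by positivity), ENNReal.ofReal_mul (by positivity)]
    simp
  rw [h, h', sqDist, ← ENNReal.ofReal_add (by positivity) (by positivity)]
  congr 1
  simp only [ENNReal.coe_toReal]
  ring

/-- The second moment under `π` of the probability of being at `j` after `n` steps. -/
noncomputable def secondMoment (P : S → PMF S) (π : PMF S) (j : S) (n : ℕ) : ℝ≥0∞ :=
  ∑' i, π i * nStep P n i j ^ 2

theorem secondMoment_le_one (P : S → PMF S) (π : PMF S) (j : S) (n : ℕ) :
    secondMoment P π j n ≤ 1 := by
  calc secondMoment P π j n ≤ ∑' i, π i * 1 := by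
        refine ENNReal.tsum_le_tsum fun i => ?_
        gcongr
        exact pow_le_one₀ zero_le (nStep_le_one P n i j)
    _ = 1 := by simp [π.tsum_coe]

theorem secondMoment_ne_top (P : S → PMF S) (π : PMF S) (j : S) (n : ℕ) :
    secondMoment P π j n ≠ ∞ :=
  ne_top_of_le_ne_top ENNReal.one_ne_top (secondMoment_le_one P π j n)

/-- Variance plus squared mean is the second moment: by Chapman–Kolmogorov, the mean of `nStep P n ·
j` under the m-step law from `i` is `nStep P (m + n) i j`. The additive form avoids truncated
subtraction in `ℝ≥0∞`. -/
theorem tsum_nStep_mul_sqDist (P : S → PMF S) (i j : S) (m n : ℕ) :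
    ∑' k, nStep P m i k * sqDist (nStep P n k j) (nStep P (m + n) i j) +
        nStep P (m + n) i j ^ 2 = ∑' k, nStep P m i k * nStep P n k j ^ 2 := by
  set a := nStep P (m + n) i j with ha
  have ha' : a ≠ ∞ := nStep_ne_top P _ _ _
  have h1 : ∑' k, nStep P m i k * sqDist (nStep P n k j) a + 2 * a ^ 2 =
      ∑' k, nStep P m i k * nStep P n k j ^ 2 + a ^ 2 := by
    calc ∑' k, nStep P m i k * sqDist (nStep P n k j) a + 2 * a ^ 2
        = ∑' k, nStep P m i k * sqDist (nStep P n k j) a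
          + ∑' k, nStep P m i k * (2 * (nStep P n k j * a)) := by
          congr 1
          rw [sq, ← mul_assoc]
          nth_rw 1 [ha]
          rw [nStep_add, ← ENNReal.tsum_mul_left, ← ENNReal.tsum_mul_right]
          exact tsum_congr fun k => by ring
      _ = ∑' k, nStep P m i k * nStep P n k j ^ 2 + ∑' k, nStep P m i k * a ^ 2 := by
          rw [← ENNReal.tsum_add, ← ENNReal.tsum_add]
          refine tsum_congr fun k => ?_
          rw [← mul_add, ← mul_add, sqDist_add_two_mul (nStep_ne_top P _ _ _) ha']
      _ = _ := by rw [ENNReal.tsum_mul_right, tsum_nStep, one_mul]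
  have hfin : a ^ 2 ≠ ∞ := ENNReal.pow_ne_top ha'
  rw [two_mul, ← add_assoc] at h1
  exact (ENNReal.add_left_inj hfin).1 h1

/-- The loss of second moment over `m` steps is the mean conditional variance. -/
theorem IsStationary.secondMoment_eq {P : S → PMF S} {π : PMF S} (hπ : IsStationary P π)
    (j : S) (m n : ℕ) :
    ∑' i, π i * ∑' k, nStep P m i k * sqDist (nStep P n k j) (nStep P (m + n) i j) +
      secondMoment P π j (m + n) = secondMoment P π j n := by
  rw [secondMoment, ← ENNReal.tsum_add]
  simp_rw [← mul_add, tsum_nStep_mul_sqDist, ← ENNReal.tsum_mul_left]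
  rw [ENNReal.tsum_comm, secondMoment]
  refine tsum_congr fun k => ?_
  rw [← hπ.tsum_mul_nStep m k, ← ENNReal.tsum_mul_right]
  simp_rw [mul_assoc]

theorem IsStationary.antitone_secondMoment {P : S → PMF S} {π : PMF S} (hπ : IsStationary P π)
    (j : S) : Antitone (secondMoment P π j) := by
  refine antitone_nat_of_succ_le fun n => ?_
  rw [← hπ.secondMoment_eq j 1 n, add_comm n 1]
  exact le_add_self

theorem IsStationary.tendsto_nStep_sub {P : S → PMF S} {π : PMF S} (hπ : IsStationary P π)
    {i k : S} {m : ℕ} (hi : π i ≠ 0) (hk : nStep P m i k ≠ 0) (j : S) :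
    Tendsto (fun n => (nStep P n k j).toReal - (nStep P (m + n) i j).toReal) atTop (𝓝 0) := by
  have hlim := tendsto_atTop_iInf (hπ.antitone_secondMoment j)
  set L := ⨅ n, secondMoment P π j n
  have hL : L ≠ ∞ := ne_top_of_le_ne_top (secondMoment_ne_top P π j 0) (iInf_le _ 0)
  have hdiff : Tendsto (fun n => secondMoment P π j n - secondMoment P π j (m + n)) atTop
      (𝓝 0) := by
    have hshift : Tendsto (fun n => secondMoment P π j (m + n)) atTop (𝓝 L) := by
      simpa only [add_comm m] using (tendsto_add_atTop_iff_nat m).2 hlim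
    simpa using ENNReal.Tendsto.sub hlim hshift (Or.inl hL)
  set c := π i * nStep P m i k
  have hc : c ≠ 0 := mul_ne_zero hi hk
  have hc' : c ≠ ∞ := ENNReal.mul_ne_top (π.apply_ne_top i) (nStep_ne_top P _ _ _)
  have hle : ∀ n, sqDist (nStep P n k j) (nStep P (m + n) i j) ≤
      c⁻¹ * (secondMoment P π j n - secondMoment P π j (m + n)) := by
    intro n
    have h1 : c * sqDist (nStep P n k j) (nStep P (m + n) i j) ≤
        secondMoment P π j n - secondMoment P π j (m + n) := by
      rw [← hπ.secondMoment_eq j m n,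
        ENNReal.add_sub_cancel_right (secondMoment_ne_top P π j (m + n)), mul_assoc]
      -- Of the double sum of nonnegative terms, only the term at `(i, k)` is kept.
      refine le_trans ?_ (ENNReal.le_tsum i)
      gcongr
      exact ENNReal.le_tsum (f := fun k =>
        nStep P m i k * sqDist (nStep P n k j) (nStep P (m + n) i j)) k
    calc sqDist (nStep P n k j) (nStep P (m + n) i j)
        = c⁻¹ * (c * sqDist (nStep P n k j) (nStep P (m + n) i j)) := by
          rw [← mul_assoc, ENNReal.inv_mul_cancel hc hc', one_mul]
      _ ≤ _ := by gcongr
  have hsq : Tendsto (fun n => sqDist (nStep P n k j) (nStep P (m + n) i j)) atTop (𝓝 0) := by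
    refine tendsto_of_tendsto_of_tendsto_of_le_of_le tendsto_const_nhds ?_ (fun _ => zero_le) hle
    simpa using ENNReal.Tendsto.const_mul hdiff (Or.inr (ENNReal.inv_ne_top.2 hc))
  have hreal := (ENNReal.tendsto_toReal ENNReal.zero_ne_top).comp hsq
  have hsqrt := (Real.continuous_sqrt.tendsto _).comp hreal
  simp only [Function.comp_def, sqDist, ENNReal.toReal_ofReal (sq_nonneg _), Real.sqrt_sq_eq_abs,
    ENNReal.toReal_zero, Real.sqrt_zero] at hsqrt
  exact (tendsto_zero_iff_abs_tendsto_zero _).2 hsqrt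

/-- If any two states can be reached simultaneously from a common state of positive stationary
mass, then the chain forgets its starting state. -/
theorem IsStationary.tendsto_nStep_sub_nStep {P : S → PMF S} {π : PMF S} (hπ : IsStationary P π)
    (hpos : ∃ i, π i ≠ 0 ∧ ∀ k, ∀ᶠ m in atTop, 0 < nStep P m i k) (j k l : S) :
    Tendsto (fun n => (nStep P n k j).toReal - (nStep P n l j).toReal) atTop (𝓝 0) := by
  obtain ⟨i, hi, hacc⟩ := hpos
  obtain ⟨m, hk, hl⟩ := ((hacc k).and (hacc l)).exists
  -- Both differences contain the same `nStep P (m + n) i j`, which cancels because `m` is common to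
  -- `k` and `l`.
  simpa using (hπ.tendsto_nStep_sub hi hk.ne' j).sub (hπ.tendsto_nStep_sub hi hl.ne' j)

theorem summable_toReal_pmf (ν : PMF S) : Summable fun i => (ν i).toReal :=
  ENNReal.summable_toReal ν.tsum_coe_ne_top

theorem tsum_toReal_pmf (ν : PMF S) : ∑' i, (ν i).toReal = 1 := by
  rw [← ENNReal.tsum_toReal_eq fun i => ν.apply_ne_top i, ν.tsum_coe, ENNReal.toReal_one]

theorem nStep_toReal_le_one (P : S → PMF S) (n : ℕ) (i j : S) : (nStep P n i j).toReal ≤ 1 := by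
  simpa using ENNReal.toReal_mono ENNReal.one_ne_top (nStep_le_one P n i j)

theorem tendsto_tsum_mul_nStep_sub {P : S → PMF S} {j l : S}
    (h : ∀ k, Tendsto (fun n => (nStep P n k j).toReal - (nStep P n l j).toReal) atTop (𝓝 0))
    (ν : PMF S) :
    Tendsto (fun n => (∑' k, ν k * nStep P n k j).toReal - (nStep P n l j).toReal) atTop
      (𝓝 0) := by
  have hdom : Tendsto (fun n => ∑' k, (ν k).toReal *
      ((nStep P n k j).toReal - (nStep P n l j).toReal)) atTop (𝓝 (∑' _ : S, (0 : ℝ))) := by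
    refine tendsto_tsum_of_dominated_convergence (bound := fun k => (ν k).toReal)
      (summable_toReal_pmf ν) (fun k => by simpa using (h k).const_mul (ν k).toReal) ?_
    refine Eventually.of_forall fun n k => ?_
    rw [Real.norm_eq_abs, abs_mul, abs_of_nonneg ENNReal.toReal_nonneg]
    refine mul_le_of_le_one_right ENNReal.toReal_nonneg (abs_le.2 ⟨?_, ?_⟩) <;>
    linarith [nStep_toReal_le_one P n k j, nStep_toReal_le_one P n l j,
      (ENNReal.toReal_nonneg : 0 ≤ (nStep P n k j).toReal),
      (ENNReal.toReal_nonneg : 0 ≤ (nStep P n l j).toReal)]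
  rw [tsum_zero] at hdom
  refine hdom.congr fun n => ?_
  have hs : Summable fun k => (ν k).toReal * (nStep P n k j).toReal :=
    (summable_toReal_pmf ν).of_nonneg_of_le
      (fun k => mul_nonneg ENNReal.toReal_nonneg ENNReal.toReal_nonneg)
      (fun k => mul_le_of_le_one_right ENNReal.toReal_nonneg (nStep_toReal_le_one P n k j))
  simp_rw [mul_sub]
  rw [hs.tsum_sub ((summable_toReal_pmf ν).mul_right _), tsum_mul_right, tsum_toReal_pmf, one_mul,
    ENNReal.tsum_toReal_eq fun k => ENNReal.mul_ne_top (ν.apply_ne_top k) (nStep_ne_top P n k j)]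
  simp_rw [ENNReal.toReal_mul]

/-- Convergence to the stationary distribution, for transition probabilities. -/
theorem IsStationary.tendsto_tsum_mul_nStep {P : S → PMF S} {π : PMF S} (hπ : IsStationary P π)
    (hpos : ∃ i, π i ≠ 0 ∧ ∀ k, ∀ᶠ m in atTop, 0 < nStep P m i k) (ν : PMF S) (j : S) :
    Tendsto (fun n => (∑' k, ν k * nStep P n k j).toReal) atTop (𝓝 (π j).toReal) := by
  -- The reference state, here `j`, is arbitrary: it cancels when the limits for `ν` and `π` are
  -- subtracted.
  have h := fun k => hπ.tendsto_nStep_sub_nStep hpos j k j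
  have hsub := (tendsto_tsum_mul_nStep_sub h ν).sub (tendsto_tsum_mul_nStep_sub h π)
  simp only [hπ.tsum_mul_nStep, sub_sub_sub_cancel_right, sub_zero] at hsub
  simpa using hsub.add_const (π j).toReal

end Mixing

/-! ### Markov property and one-dimensional laws. -/

section Law

variable [MeasurableSpace S] [Countable S] [MeasurableSingletonClass S]
variable {Ω : Type*} [MeasurableSpace Ω] {P : S → PMF S} {ν : PMF S} {μ : Measure Ω}
  {X : ℕ → Ω → S}

/-- The Markov property, for an event `A` of the trajectory up to time `n`. -/
theorem IsMarkovChain.measure_inter_next [IsFiniteMeasure μ] (h : IsMarkovChain P ν μ X) (n : ℕ)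
    (A : Set (Finset.Iic n → S)) (k j : S) (hA : ∀ y ∈ A, y ⟨n, Finset.mem_Iic.2 le_rfl⟩ = k) :
    μ ({ω | (fun i : Finset.Iic n => X i ω) ∈ A} ∩ {ω | X (n + 1) ω = j}) =
      μ {ω | (fun i : Finset.Iic n => X i ω) ∈ A} * P k j := by
  set r : Ω → Finset.Iic n → S := fun ω i => X i ω
  have hr : Measurable r := measurable_pi_lambda _ fun i => h.measurable i
  have hset : ∀ y, MeasurableSet (r ⁻¹' {y}) := fun y => hr (measurableSet_singleton y)
  have hj : MeasurableSet {ω | X (n + 1) ω = j} := h.measurable (n + 1) (measurableSet_singleton j)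
  have hdisj : A.PairwiseDisjoint fun y => r ⁻¹' {y} := fun y _ z _ hyz =>
    (Set.disjoint_singleton.2 hyz).preimage r
  have hU : {ω | r ω ∈ A} = ⋃ y ∈ A, r ⁻¹' {y} := by ext; simp
  have hpt : ∀ y ∈ A, μ (r ⁻¹' {y} ∩ {ω | X (n + 1) ω = j}) = μ (r ⁻¹' {y}) * P k j := by
    intro y hy
    by_cases h0 : μ (r ⁻¹' {y}) = 0
    · rw [h0, zero_mul]
      exact measure_mono_null Set.inter_subset_left h0
    -- The finite history `y` is extended to all times; the value `k` after time `n` is a filler.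
    · have hx : {ω | ∀ m ≤ n, X m ω = if hm : m ≤ n then y ⟨m, Finset.mem_Iic.2 hm⟩ else k} =
          r ⁻¹' {y} := by
        ext ω
        simp only [Set.mem_ofPred_eq, Set.mem_preimage, Set.mem_singleton_iff, funext_iff, r]
        refine ⟨fun hω i => ?_, fun hω m hm => ?_⟩
        · have hi := Finset.mem_Iic.1 i.2
          simpa [hi] using hω i hi
        · simpa [hm] using hω ⟨m, Finset.mem_Iic.2 hm⟩
      have hm := h.markov n (fun m => if hm : m ≤ n then y ⟨m, Finset.mem_Iic.2 hm⟩ else k) j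
      rw [hx] at hm
      have hm := hm h0
      simp only [le_refl, dite_true, hA y hy] at hm
      rw [← hm, mul_comm, cond_mul_eq_inter (hset y)]
  rw [hU, Set.iUnion₂_inter, measure_biUnion (Set.to_countable A)
      (fun y hy z hz hyz => (hdisj hy hz hyz).mono Set.inter_subset_left Set.inter_subset_left)
      (fun y _ => (hset y).inter hj),
    measure_biUnion (Set.to_countable A) hdisj (fun y _ => hset y), ← ENNReal.tsum_mul_right]
  exact tsum_congr fun y => hpt y y.2

/-- Splitting by the state at time `n` makes the Markov property usable for every `A`: the full
space yields the law of the chain, avoidance of a state the taboo recursion. -/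
theorem IsMarkovChain.measure_inter_next_eq_tsum [IsFiniteMeasure μ] (h : IsMarkovChain P ν μ X)
    (n : ℕ) (A : Set (Finset.Iic n → S)) (j : S) :
    μ ({ω | (fun i : Finset.Iic n => X i ω) ∈ A} ∩ {ω | X (n + 1) ω = j}) =
      ∑' k, μ ({ω | (fun i : Finset.Iic n => X i ω) ∈ A} ∩ {ω | X n ω = k}) * P k j := by
  have hr : Measurable fun ω (i : Finset.Iic n) => X i ω :=
    measurable_pi_lambda _ fun i => h.measurable i
  have hA : MeasurableSet {ω | (fun i : Finset.Iic n => X i ω) ∈ A} := hr A.to_countable.measurableSet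
  have hj : MeasurableSet {ω | X (n + 1) ω = j} := h.measurable (n + 1) (measurableSet_singleton j)
  have hk : ∀ k, MeasurableSet {ω | X n ω = k} := fun k =>
    h.measurable n (measurableSet_singleton k)
  have hU : {ω | (fun i : Finset.Iic n => X i ω) ∈ A} ∩ {ω | X (n + 1) ω = j} =
      ⋃ k, ({ω | (fun i : Finset.Iic n => X i ω) ∈ A} ∩ {ω | X n ω = k}) ∩
        {ω | X (n + 1) ω = j} := by
    ext ω; simp
  rw [hU, measure_iUnion]
  · refine tsum_congr fun k => ?_
    exact h.measure_inter_next n (A ∩ {y | y ⟨n, Finset.mem_Iic.2 le_rfl⟩ = k}) k j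
      fun y hy => hy.2
  · intro k l hkl
    refine Set.disjoint_left.2 fun ω h1 h2 => hkl ?_
    exact h1.1.2.symm.trans h2.1.2
  · exact fun k => (hA.inter (hk k)).inter hj

/-- The law of a Markov chain at time `n`. -/
theorem IsMarkovChain.measure_eq [IsFiniteMeasure μ] (h : IsMarkovChain P ν μ X) (n : ℕ) (j : S) :
    μ {ω | X n ω = j} = ∑' i, ν i * nStep P n i j := by
  induction n generalizing j with
  | zero =>
    rw [h.initial, tsum_eq_single j fun k hk => by simp [nStep, hk.symm]]
    simp [nStep]
  | succ n ih =>
    have hn := h.measure_inter_next_eq_tsum n Set.univ j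
    simp only [Set.mem_univ, Set.ofPred_true, Set.univ_inter, ih] at hn
    rw [hn]
    simp only [nStep]
    simp_rw [← ENNReal.tsum_mul_left, ← ENNReal.tsum_mul_right]
    rw [ENNReal.tsum_comm]
    simp_rw [mul_assoc]

theorem pathMeasure_pure_eq (P : S → PMF S) (n : ℕ) (i j : S) :
    pathMeasure P (PMF.pure i) {ω | ω n = j} = nStep P n i j := by
  rw [(isMarkovChain_pathMeasure P (PMF.pure i)).measure_eq n j,
    tsum_eq_single i fun k hk => by simp [hk]]
  simp

end Law

/-! ### Aperiodicity and eventual positivity. -/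

section Aperiodic

variable [MeasurableSpace S] [Countable S] [MeasurableSingletonClass S]

/-- Possible return times are closed under addition, and an additive submonoid of ℕ generated by a
set of gcd 1 contains all large integers. -/
theorem IsAperiodic.eventually_nStep_self_pos {P : S → PMF S} (h : IsAperiodic P) (i : S) :
    ∀ᶠ n in atTop, 0 < nStep P n i i := by
  have hi := h i
  simp only [period, pathMeasure_pure_eq] at hi
  obtain ⟨N, hN⟩ := Nat.exists_mem_closure_of_ge {n : ℕ | 1 ≤ n ∧ 0 < nStep P n i i}
  filter_upwards [eventually_ge_atTop N] with n hn
  have hmem := hN n hn (by rw [hi]; exact one_dvd n)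
  clear hn
  induction hmem using AddSubmonoid.closure_induction with
  | mem x hx => exact hx.2
  | zero => simp [nStep]
  | add x y _ _ hx hy => exact nStep_add_pos hx hy

theorem IsAperiodic.eventually_nStep_pos {P : S → PMF S} (h : IsAperiodic P)
    (hirr : IsIrreducible P) (i j : S) : ∀ᶠ n in atTop, 0 < nStep P n i j := by
  obtain ⟨m, hm⟩ := (hirr i j).1
  obtain ⟨N, hN⟩ := eventually_atTop.1 (h.eventually_nStep_self_pos i)
  filter_upwards [eventually_ge_atTop (N + m)] with n hn
  have := nStep_add_pos (hN (n - m) (by omega)) hm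
  rwa [Nat.sub_add_cancel (by omega)] at this

end Aperiodic

/-! ### A stationary distribution from excursions. -/

section Existence

/-- The event that the trajectory does not visit `i` at the times `1, …, n`. -/
def avoids (i : S) (n : ℕ) : Set (ℕ → S) := {ω | ∀ m, 1 ≤ m → m ≤ n → ω m ≠ i}

theorem measurableSet_avoids [MeasurableSpace S] [MeasurableSingletonClass S]
    (i : S) (n : ℕ) : MeasurableSet (avoids i n) := by
  have : avoids i n = ⋂ m, ⋂ (_ : 1 ≤ m), ⋂ (_ : m ≤ n), {ω : ℕ → S | ω m = i}ᶜ := by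
    ext ω; simp [avoids]
  rw [this]
  exact .iInter fun m => .iInter fun _ => .iInter fun _ =>
    MeasurableSet.compl (measurable_pi_apply (X := fun _ : ℕ => S) m (measurableSet_singleton i))

/-- `avoids i n` is the event τ_i > n, so this is the tail-sum formula for τ_i, of which one
inequality suffices. -/
theorem tsum_indicator_avoids_le_hitTime (i : S) (ω : ℕ → S) :
    ∑' n, (avoids i n).indicator (1 : (ℕ → S) → ℝ≥0∞) ω ≤ (hitTime i ω : ℝ≥0∞) := by
  classical
  by_cases hex : ∃ n, 1 ≤ n ∧ ω n = i
  · have hN := Nat.find_spec hex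
    set N := Nat.find hex
    have hle : (N : ℕ∞) ≤ hitTime i ω :=
      le_iInf₂ fun n hn => by exact_mod_cast Nat.find_min' hex hn
    calc ∑' n, (avoids i n).indicator (1 : (ℕ → S) → ℝ≥0∞) ω
        = ∑ n ∈ Finset.range N, (avoids i n).indicator (1 : (ℕ → S) → ℝ≥0∞) ω := by
          refine tsum_eq_sum fun n hn => Set.indicator_of_notMem (fun hω => ?_) _
          exact hω N hN.1 (by simpa using hn) hN.2
      _ ≤ ∑ n ∈ Finset.range N, 1 :=
          Finset.sum_le_sum fun n _ => Set.indicator_le_self' (fun _ _ => zero_le) ω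
      _ = ((N : ℕ∞) : ℝ≥0∞) := by simp
      _ ≤ _ := ENat.toENNReal_mono hle
  · have : hitTime i ω = ⊤ := by
      simp only [hitTime, iInf_eq_top]
      exact fun n hn => (hex ⟨n, hn⟩).elim
    simp [this]

variable [MeasurableSpace S] [Countable S] [MeasurableSingletonClass S]

/-- The probability, starting from `i`, of being at `j` at time `n` without having returned
to `i`. -/
noncomputable def taboo (P : S → PMF S) (i : S) (n : ℕ) (j : S) : ℝ≥0∞ :=
  pathMeasure P (PMF.pure i) (avoids i n ∩ {ω | ω n = j})

theorem tsum_taboo (P : S → PMF S) (i : S) (n : ℕ) :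
    ∑' j, taboo P i n j = pathMeasure P (PMF.pure i) (avoids i n) := by
  have hU : avoids i n = ⋃ j, avoids i n ∩ {ω : ℕ → S | ω n = j} := by ext; simp
  conv_rhs => rw [hU]
  rw [measure_iUnion]
  · rfl
  · exact fun k l hkl => Set.disjoint_left.2 fun ω h1 h2 => hkl (h1.2.symm.trans h2.2)
  · exact fun k => (measurableSet_avoids i n).inter
      (measurable_pi_apply (X := fun _ : ℕ => S) n (measurableSet_singleton k))

theorem taboo_zero (P : S → PMF S) (i j : S) : taboo P i 0 j = PMF.pure i j := by
  have : avoids i 0 = (Set.univ : Set (ℕ → S)) := by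
    ext ω; simp only [avoids, Set.mem_ofPred_eq, Set.mem_univ, iff_true]; intro m; omega
  rw [taboo, this, Set.univ_inter, (isMarkovChain_pathMeasure P (PMF.pure i)).initial]

theorem taboo_succ_self (P : S → PMF S) (i : S) (n : ℕ) : taboo P i (n + 1) i = 0 := by
  have : avoids i (n + 1) ∩ {ω : ℕ → S | ω (n + 1) = i} = ∅ :=
    Set.eq_empty_of_forall_notMem fun ω hω => hω.1 (n + 1) (by omega) le_rfl hω.2
  rw [taboo, this, measure_empty]

theorem taboo_succ (P : S → PMF S) {i j : S} (hij : j ≠ i) (n : ℕ) :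
    taboo P i (n + 1) j = ∑' k, taboo P i n k * P k j := by
  have hA : avoids i n = {ω : ℕ → S | (fun m : Finset.Iic n => ω m) ∈
      {y : Finset.Iic n → S | ∀ m, 1 ≤ m.1 → y m ≠ i}} := by
    ext ω
    refine ⟨fun h m hm => h m hm (Finset.mem_Iic.1 m.2), fun h m hm hmn => ?_⟩
    exact h ⟨m, Finset.mem_Iic.2 hmn⟩ hm
  have hsucc : avoids i (n + 1) ∩ {ω : ℕ → S | ω (n + 1) = j} =
      avoids i n ∩ {ω : ℕ → S | ω (n + 1) = j} := by
    ext ω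
    refine ⟨fun h => ⟨fun m hm hmn => h.1 m hm (by omega), h.2⟩, fun h => ⟨fun m hm hmn => ?_, h.2⟩⟩
    rcases Nat.lt_or_ge n m with hlt | hge
    · obtain rfl : m = n + 1 := by omega
      exact fun hi => hij (h.2.symm.trans hi)
    · exact h.1 m hm hge
  simp only [taboo]
  rw [hsucc, hA]
  exact (isMarkovChain_pathMeasure P (PMF.pure i)).measure_inter_next_eq_tsum n _ j

theorem tsum_measure_avoids_le (P : S → PMF S) (i : S) :
    ∑' n, pathMeasure P (PMF.pure i) (avoids i n) ≤ meanReturnTime P i := by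
  calc ∑' n, pathMeasure P (PMF.pure i) (avoids i n)
      = ∑' n, ∫⁻ ω, (avoids i n).indicator 1 ω ∂(pathMeasure P (PMF.pure i)) :=
        tsum_congr fun n => (lintegral_indicator_one (measurableSet_avoids i n)).symm
    _ = ∫⁻ ω, ∑' n, (avoids i n).indicator 1 ω ∂(pathMeasure P (PMF.pure i)) :=
        (lintegral_tsum fun n =>
          (measurable_one.indicator (measurableSet_avoids i n)).aemeasurable).symm
    _ ≤ _ := lintegral_mono fun ω => tsum_indicator_avoids_le_hitTime i ω

/-- The expected number of visits to `j` before the first return to `i`. -/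
noncomputable def excursionMeasure (P : S → PMF S) (i j : S) : ℝ≥0∞ := ∑' n, taboo P i n j

theorem tsum_excursionMeasure_le (P : S → PMF S) (i : S) :
    ∑' j, excursionMeasure P i j ≤ meanReturnTime P i := by
  simp only [excursionMeasure]
  rw [ENNReal.tsum_comm]
  simp_rw [tsum_taboo]
  exact tsum_measure_avoids_le P i

theorem excursionMeasure_self (P : S → PMF S) (i : S) : excursionMeasure P i i = 1 := by
  rw [excursionMeasure, tsum_eq_zero_add' ENNReal.summable]
  simp [taboo_zero, taboo_succ_self]

/-- One step of the chain shifts the time index in the sum by one, and the lost term at time 0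
vanishes because the excursion starts at `i ≠ j`. -/
theorem tsum_excursionMeasure_mul_of_ne (P : S → PMF S) {i j : S} (hij : j ≠ i) :
    ∑' k, excursionMeasure P i k * P k j = excursionMeasure P i j := by
  simp only [excursionMeasure]
  rw [tsum_eq_zero_add' (f := fun n => taboo P i n j) ENNReal.summable, taboo_zero]
  simp_rw [← ENNReal.tsum_mul_right]
  rw [ENNReal.tsum_comm]
  simp [taboo_succ P hij, hij]

/-- Stationarity at `i` follows from stationarity elsewhere by conservation of total mass. -/
theorem tsum_excursionMeasure_mul {P : S → PMF S} {i : S} (hi : meanReturnTime P i < ∞) (j : S) :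
    ∑' k, excursionMeasure P i k * P k j = excursionMeasure P i j := by
  classical
  rcases eq_or_ne j i with rfl | hij
  · have htot : ∑' l, ∑' k, excursionMeasure P j k * P k l = ∑' l, excursionMeasure P j l := by
      rw [ENNReal.tsum_comm]
      simp_rw [ENNReal.tsum_mul_left, PMF.tsum_coe, mul_one]
    have hfin : ∑' l, excursionMeasure P j l ≠ ∞ :=
      ((tsum_excursionMeasure_le P j).trans_lt hi).ne
    rw [ENNReal.tsum_eq_add_tsum_ite (f := fun l => ∑' k, excursionMeasure P j k * P k l) j,
      ENNReal.tsum_eq_add_tsum_ite (f := excursionMeasure P j) j] at htot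
    have hrest : ∑' l, (if l = j then 0 else ∑' k, excursionMeasure P j k * P k l) =
        ∑' l, if l = j then 0 else excursionMeasure P j l := by
      refine tsum_congr fun l => ?_
      split_ifs with hl
      · rfl
      · exact tsum_excursionMeasure_mul_of_ne P hl
    rw [hrest] at htot
    -- Cancelling the mass off `j` needs it to be finite, which is where positive recurrence enters.
    refine (ENNReal.add_left_inj (ne_top_of_le_ne_top hfin ?_)).1 htot
    refine ENNReal.tsum_le_tsum fun l => ?_
    split_ifs
    · exact zero_le
    · exact le_rfl
  · exact tsum_excursionMeasure_mul_of_ne P hij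

theorem exists_isStationary {P : S → PMF S} {i : S} (hi : meanReturnTime P i < ∞) :
    ∃ π, IsStationary P π := by
  have h0 : ∑' j, excursionMeasure P i j ≠ 0 := fun h => by
    simpa [excursionMeasure_self] using ENNReal.tsum_eq_zero.1 h i
  have hfin : ∑' j, excursionMeasure P i j ≠ ∞ := ((tsum_excursionMeasure_le P i).trans_lt hi).ne
  refine ⟨PMF.normalize (excursionMeasure P i) h0 hfin, fun j => ?_⟩
  simp only [PMF.normalize_apply]
  rw [← tsum_excursionMeasure_mul hi j, ← ENNReal.tsum_mul_right]
  exact tsum_congr fun k => by ring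

end Existence

end MarkovChain

/-! ### The convergence theorem. -/

theorem mainTheorem1 {S : Type*} [Countable S] [Nonempty S] [MeasurableSpace S]
    [MeasurableSingletonClass S] (P : S → PMF S)
    (hirr : MarkovChain.IsIrreducible P) (haper : MarkovChain.IsAperiodic P)
    (hrec : MarkovChain.IsPositiveRecurrent P) :
    (∃! π : PMF S, MarkovChain.IsStationary P π) ∧
    ∀ π : PMF S, MarkovChain.IsStationary P π →
      ∀ (ν : PMF S) {Ω : Type*} [MeasurableSpace Ω] (μ : Measure Ω) [IsProbabilityMeasure μ]
        (X : ℕ → Ω → S), MarkovChain.IsMarkovChain P ν μ X →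
        ∀ j : S, Tendsto (fun n => μ.real {ω | X n ω = j}) atTop (𝓝 (π j).toReal) := by
  have hpos : ∀ π : PMF S, ∃ i, π i ≠ 0 ∧ ∀ k, ∀ᶠ m in atTop, 0 < MarkovChain.nStep P m i k := by
    intro π
    obtain ⟨i, hi⟩ := π.support_nonempty
    exact ⟨i, (π.mem_support_iff i).1 hi, haper.eventually_nStep_pos hirr i⟩
  obtain ⟨i⟩ := ‹Nonempty S›
  obtain ⟨π, hπ⟩ := MarkovChain.exists_isStationary (hrec i)
  refine ⟨⟨π, hπ, fun π' hπ' => ?_⟩, ?_⟩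
  · refine PMF.ext fun j => ?_
    have hlim := hπ.tendsto_tsum_mul_nStep (hpos π) π' j
    -- Started from `π'`, the convergent sequence is constant.
    simp only [hπ'.tsum_mul_nStep] at hlim
    exact (ENNReal.toReal_eq_toReal_iff' (π'.apply_ne_top j) (π.apply_ne_top j)).1
      (tendsto_nhds_unique tendsto_const_nhds hlim)
  · intro π hπ ν Ω _ μ _ X hX j
    simp only [Measure.real, hX.measure_eq]
    exact hπ.tendsto_tsum_mul_nStep (hpos π) ν j
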